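/- Let $X=(V,E)$ be a finite digraph (i.e. $V$ is finite and $E\subseteq V\times V$, loops allowed) with vertices labeled $v_1,\ldots,v_n$ in a fixed order, $n=|V|$. Let $x_1,x_2,\ldots$ be noncommuting variables, and consider formal power series in them with coefficients in a commutative ring. For a coloring $f:V\to\mathbb{P}=\{1,2,\ldots\}$, a listing $\tau=(\tau_1,\ldots,\tau_n)$ of $V$ (each vertex occurring exactly once) is called $(f,X)$-friendly if $f(\tau_1)\le f(\tau_2)\le\cdots\le f(\tau_n)$ and $f(\tau_j)<f(\tau_{j+1})$ for each $1\le j\le n-1$ with $(\tau_j,\tau_{j+1})\in E$. The Redei-Berge function of $X$ in noncommuting variables is $$W_X=\sum_{f:V\to\mathbb{P}}\ \sum_{\substack{\tau \text{ a listing of } V\\ (f,X)\text{-friendly}}} x_{f(v_1)}x_{f(v_2)}\cdots x_{f(v_n)}.$$ For a partition $\pi$ of the set $\{1,\ldots,n\}$, the power sum function in noncommuting variables is $p_\pi=\sum x_{i_1}x_{i_2}\cdots x_{i_n}$, the sum being over all sequences $(i_1,\ldots,i_n)$ of positive integers such that $i_j=i_k$ whenever $j$ and $k$ lie in the same block of $\pi$.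 Let $\overline X=(V,(V\times V)\setminus E)$ be the complement of $X$. A cycle $\gamma$ of a permutation $\sigma$ of $V$ (fixed points count as cycles of length $1$) is called a cycle of a digraph $Y$ on $V$ if $(u,\sigma(u))$ is an edge of $Y$ for every $u$ in $\gamma$. Let $\mathbb{S}_V(X,\overline X)$ be the set of permutations $\sigma$ of $V$ each of whose cycles is a cycle of $X$ or a cycle of $\overline X$. For a permutation $\sigma$ of $V$, let $\varphi(\sigma)=\sum_\gamma(\ell(\gamma)-1)$, where $\gamma$ runs over the cycles of $\sigma$ that are cycles of $X$ and $\ell(\gamma)$ is the length of $\gamma$; and let $\mathrm{Type}(\sigma)$ be the partition of $\{1,\ldots,n\}$ in which $j$ and $k$ are in the same block if and only if $v_j$ and $v_k$ belong to the same cycle of $\sigma$. Then $$W_X=\sum_{\sigma\in\mathbb{S}_V(X,\overline X)}(-1)^{\varphi(\sigma)}\,p_{\mathrm{Type}(\sigma)}.$$ -/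

import Mathlib

namespace RedeiBerge

/-- Formal power series with coefficients in `R` in the noncommuting variables `x₁, x₂, x₃, …`
(indexed by the positive integers): a series is the function sending each word (noncommutative
monomial) to its coefficient. -/
abbrev NCSeries (R : Type*) : Type _ := FreeMonoid ℕ+ → R

/-- The noncommutative monomial `x_{i₁} x_{i₂} ⋯ x_{iₙ}`, as a word. -/
def word {n : ℕ} (i : Fin n → ℕ+) : FreeMonoid ℕ+ := FreeMonoid.ofList (List.ofFn i)

theorem word_injective (n : ℕ) : Function.Injective (word : (Fin n → ℕ+) → FreeMonoid ℕ+) :=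
  fun _ _ h => List.ofFn_injective (FreeMonoid.ofList.injective h)

open Classical in
/-- The monomial `x_{i₁} x_{i₂} ⋯ x_{iₙ}`, as a formal power series. -/
noncomputable def monomial (R : Type*) [CommRing R] {n : ℕ} (i : Fin n → ℕ+) : NCSeries R :=
  fun w => if w = word i then 1 else 0

/-- The formal sum of a family of series, taken coefficient by coefficient. It is only used for
families in which every word occurs in finitely many members, see `finite_support_monomial` and
`finite_support_smul_monomial`. -/
noncomputable def formalSum {R : Type*} [CommRing R] {ι : Type*} (F : ι → NCSeries R) :
    NCSeries R :=
  fun w => ∑ᶠ k, F k w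

/-- The digraph `X` has vertex set `V` and edges `(u, v)` for `X.Adj u v`, loops allowed.
A listing `σ` of the vertices is `(f, X)`-friendly if `f` is weakly increasing along `σ`, and
strictly increasing at each step of `σ` that is an edge of `X`. -/
def IsFriendly {V : Type*} {n : ℕ} (X : Digraph V) (f : V → ℕ+) (σ : Fin n ≃ V) : Prop :=
  (∀ i j : Fin n, (i : ℕ) + 1 = (j : ℕ) → f (σ i) ≤ f (σ j)) ∧
    ∀ i j : Fin n, (i : ℕ) + 1 = (j : ℕ) → X.Adj (σ i) (σ j) → f (σ i) < f (σ j)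

open Classical in
/-- The indicator `δ_f(σ)` of the friendly listings. -/
noncomputable def friendlyIndicator (R : Type*) [CommRing R] {V : Type*} {n : ℕ} (X : Digraph V)
    (f : V → ℕ+) (σ : Fin n ≃ V) : R :=
  if IsFriendly X f σ then 1 else 0

/-- The Redei-Berge function in noncommuting variables of the digraph `X` with vertices labeled
`v 0, …, v (n - 1)`:
`W_X = ∑_{f : V → ℙ} ∑_{σ listing} δ_f(σ) x_{f(v₁)} x_{f(v₂)} ⋯ x_{f(vₙ)}`. -/
noncomputable def W (R : Type*) [CommRing R] {V : Type*} [Fintype V] [DecidableEq V] {n : ℕ}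
    (X : Digraph V) (v : Fin n ≃ V) : NCSeries R :=
  formalSum fun f : V → ℕ+ =>
    ∑ σ : Fin n ≃ V, friendlyIndicator R X f σ • monomial R (fun j => f (v j))

/-- The power sum symmetric function in noncommuting variables `p_π` of a set partition `π`:
the sum of `x_{i₁} x_{i₂} ⋯ x_{iₙ}` over all sequences with `i_j = i_k` whenever `j` and `k` are in
the same block of `π`. -/
noncomputable def powerSum (R : Type*) [CommRing R] {n : ℕ}
    (π : Finpartition (Finset.univ : Finset (Fin n))) : NCSeries R :=
  formalSum fun i : {i : Fin n → ℕ+ // ∀ B ∈ π.parts, ∀ j ∈ B, ∀ k ∈ B, i j = i k} =>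
    monomial R i.1

open Classical in
/-- The partition of `α` into the cycles of the permutation `σ`, fixed points being cycles of
length one. A cycle `γ` of `σ` is represented by the set of its elements; `σ` restricted to `γ`
recovers the cyclic order, and the length of the cycle is the cardinality of the set. -/
noncomputable def cyclePartition {α : Type*} [Fintype α] [DecidableEq α] (σ : Equiv.Perm α) :
    Finpartition (Finset.univ : Finset α) :=
  Finpartition.ofSetoid (Equiv.Perm.SameCycle.setoid σ)

/-- The cycle of `σ` with set of elements `γ` is a cycle of the digraph `X`: every pair
`(u, σ u)` of consecutive elements of the cycle is an edge of `X`. In particular a fixed point `u`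
of `σ` is a cycle of `X` exactly when `X` has a loop at `u`. -/
def IsCycleOf {V : Type*} (X : Digraph V) (σ : Equiv.Perm V) (γ : Finset V) : Prop :=
  ∀ u ∈ γ, X.Adj u (σ u)

open Classical in
/-- The permutations of `V` each of whose cycles is a cycle of `X` or a cycle of the complement
of `X`, the digraph whose edges are all the pairs (loops included) that are not edges of `X`. -/
noncomputable def permsOf {V : Type*} [Fintype V] [DecidableEq V] (X : Digraph V) :
    Finset (Equiv.Perm V) :=
  Finset.univ.filter fun σ =>
    ∀ γ ∈ (cyclePartition σ).parts, IsCycleOf X σ γ ∨ IsCycleOf Xᶜ σ γ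

open Classical in
/-- `φ(σ) = ∑_γ (ℓ(γ) - 1)`, over the cycles `γ` of `σ` that are cycles of `X`. -/
noncomputable def phi {V : Type*} [Fintype V] [DecidableEq V] (X : Digraph V) (σ : Equiv.Perm V) : ℕ :=
  ∑ γ ∈ (cyclePartition σ).parts.filter (fun γ => IsCycleOf X σ γ), (γ.card - 1)

/-- `Type(σ)`, for a permutation `σ` of the vertices labeled `v 0, …, v (n - 1)`: the set partition
of the labels whose blocks are the cycles of `σ`, seen through the labeling as a permutation of
the labels. -/
noncomputable def cycleType {V : Type*} {n : ℕ} (v : Fin n ≃ V) (σ : Equiv.Perm V) :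
    Finpartition (Finset.univ : Finset (Fin n)) :=
  cyclePartition (v.symm.permCongr σ)

/-- The formal sum defining `p_π` is locally finite. -/
theorem finite_support_monomial (R : Type*) [CommRing R] {n : ℕ} (P : (Fin n → ℕ+) → Prop)
    (w : FreeMonoid ℕ+) :
    (Function.support fun i : {i : Fin n → ℕ+ // P i} => monomial R i.1 w).Finite := by
  refine Set.Subsingleton.finite fun a ha b hb => Subtype.ext (word_injective n ?_)
  simp only [Function.mem_support, monomial, ne_eq, ite_eq_right_iff, not_forall] at ha hb
  exact ha.1.symm.trans hb.1

/-- The formal sum defining `W_X` is locally finite. -/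
theorem finite_support_smul_monomial (R : Type*) [CommRing R] {V : Type*} [Fintype V]
    [DecidableEq V] {n : ℕ} (X : Digraph V) (v : Fin n ≃ V) (w : FreeMonoid ℕ+) :
    (Function.support fun f : V → ℕ+ =>
      (∑ σ : Fin n ≃ V, friendlyIndicator R X f σ • monomial R (fun j => f (v j))) w).Finite := by
  have key : ∀ f : V → ℕ+, (∑ σ : Fin n ≃ V,
      friendlyIndicator R X f σ • monomial R (fun j => f (v j))) w ≠ 0 →
      w = word (fun j => f (v j)) := by
    intro f hf
    by_contra h
    exact hf (by simp [Finset.sum_apply, monomial, h])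
  refine Set.Subsingleton.finite fun a ha b hb => ?_
  have h := word_injective n ((key a ha).symm.trans (key b hb))
  funext u
  simpa using congrFun h (v.symm u)

end RedeiBerge

/-! Compare coefficients. The word of `f` (read along `v`) has in `W` a coefficient equal to the
number of friendly listings. Friendliness constrains consecutive pairs only, so its indicator is a
product of factors `1 + b u w`, with `b = -1` on forbidden pairs and `0` elsewhere.

Expanding that product gives sets `F` of vertices whose successor is prescribed by a map `g`. If `g`
is injective and acyclic on `F`, then `(n - |F|)!` listings obey it, and exactly as many
permutations extend it; otherwise there is no such listing, and no such permutation without a cycle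
inside `F` (`card_listings_eq_card_perms`). So listings can be traded for permutations `σ`, with `F`
containing no full cycle of `σ`. The sum over `F` then factors over cycles into `∏ (1 + b) - ∏ b`
(`sum_listings_eq_sum_prod_cycles`).

Such a factor vanishes unless `f` is constant on the cycle. In that case forbidden means edge of
`X`, and the factor is `1` on cycles of `Xᶜ`, `(-1) ^ (ℓ - 1)` on cycles of `X`, and `0` on all
others (`prod_cycles_eq`). -/

namespace RedeiBerge

/-! ### Counting lists and permutations with prescribed successors. -/

theorem infix_pair_append_cons {α : Type*} {x y a : α} {l₁ l₂ : List α}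
    (hx : x ≠ a) (hy : y ≠ a) :
    [x, y] <:+: l₁ ++ a :: l₂ ↔ [x, y] <:+: l₁ ∨ [x, y] <:+: l₂ := by
  constructor
  · rintro ⟨s, t, h⟩
    simp only [List.append_assoc, List.cons_append, List.nil_append] at h
    rw [List.append_eq_append_iff] at h
    rcases h with ⟨c, rfl, h⟩ | ⟨c, rfl, h⟩
    · rcases c with _ | ⟨c1, _ | ⟨c2, c⟩⟩
      · simp at h; exact absurd h.1 hx
      · simp at h; exact absurd h.2.1 hy
      · simp at h
        obtain ⟨rfl, rfl, rfl⟩ := h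
        exact Or.inl ⟨s, c, by simp⟩
    · rcases c with _ | ⟨c1, c⟩
      · simp at h; exact absurd h.1.symm hx
      · simp at h
        exact Or.inr ⟨c, t, by simp [h.2]⟩
  · rintro (h | h)
    · exact h.trans (List.prefix_append _ _).isInfix
    · exact h.trans ((List.suffix_cons _ _).trans (List.suffix_append _ _)).isInfix

theorem infix_pair_append_cons_of_ne {α : Type*} {x y b : α} {l₁ l₂ : List α} (hy : y ≠ b) :
    [x, y] <:+: l₁ ++ b :: l₂ ↔ [x, y] <:+: l₁ ∨ [x, y] <:+: b :: l₂ := by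
  constructor
  · rintro ⟨s, t, h⟩
    simp only [List.append_assoc, List.cons_append, List.nil_append] at h
    rw [List.append_eq_append_iff] at h
    rcases h with ⟨c, rfl, h⟩ | ⟨c, rfl, h⟩
    · rcases c with _ | ⟨c1, _ | ⟨c2, c⟩⟩
      · simp at h; exact Or.inr ⟨[], t, by simp [h]⟩
      · simp at h; exact absurd h.2.1 hy
      · simp at h
        obtain ⟨rfl, rfl, rfl⟩ := h
        exact Or.inl ⟨s, c, by simp⟩
    · exact Or.inr ⟨c, t, by simp [h]⟩
  · rintro (h | h)
    · exact h.trans (List.prefix_append _ _).isInfix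
    · exact h.trans (List.suffix_append _ _).isInfix

/-- `g` has no nonempty invariant set inside `F`. -/
def IsAcyclicOn {V : Type*} (g : V → V) (F : Finset V) : Prop :=
  ∀ C ⊆ F, (∀ c ∈ C, g c ∈ C) → C = ∅

theorem IsAcyclicOn.congr {V : Type*} {g g' : V → V} {F : Finset V} (h : IsAcyclicOn g F)
    (e : ∀ u ∈ F, g u = g' u) : IsAcyclicOn g' F :=
  fun C hC hinv => h C hC fun c hc => by rw [e c (hC hc)]; exact hinv c hc

open Classical in
/-- The orderings of `S` in which every `u ∈ F` is immediately followed by `g u`. -/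
noncomputable def orderings {V : Type*} (g : V → V) (S F : Finset V) : Finset (List V) :=
  S.toList.permutations.toFinset.filter fun l => ∀ u ∈ F, [u, g u] <:+: l

theorem mem_orderings {V : Type*} {g : V → V} {S F : Finset V} {l : List V} :
    l ∈ orderings g S F ↔ (l.Nodup ∧ ∀ x, x ∈ l ↔ x ∈ S) ∧ ∀ u ∈ F, [u, g u] <:+: l := by
  simp only [orderings, Finset.mem_filter, List.mem_toFinset, List.mem_permutations]
  refine and_congr_left fun _ => ⟨fun h => ⟨h.symm.nodup S.nodup_toList, fun x => ?_⟩, fun h => ?_⟩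
  · rw [h.mem_iff, Finset.mem_toList]
  · exact (List.perm_ext_iff_of_nodup h.1 S.nodup_toList).2 fun x => by simp [h.2]

/-- Induction on `|F|`, by contraction: deleting a suitable `a ∈ F` loses nothing, since `a` can be
put back just before `g a`. -/
theorem card_orderings {V : Type*} (g : V → V) :
    ∀ (k : ℕ) (S F : Finset V), F.card = k → F ⊆ S → (∀ u ∈ F, g u ∈ S) → Set.InjOn g F →
      IsAcyclicOn g F → (orderings g S F).card = (S.card - k).factorial := by
  classical
  intro k
  induction k with
  | zero =>
    intro S F hF _ _ _ _
    obtain rfl := Finset.card_eq_zero.1 hF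
    simp only [orderings, Finset.notMem_empty, false_imp_iff, implies_true, Finset.filter_true]
    rw [List.toFinset_card_of_nodup (List.nodup_permutations _ S.nodup_toList),
      List.length_permutations, Finset.length_toList, Nat.sub_zero]
  | succ k ih =>
    intro S F hF hFS hg hinj hac
    -- Otherwise `g` would map `F` onto itself, against acyclicity. No prescribed pair ends in this
    -- `a`, so deleting it breaks only its own pair.
    obtain ⟨a, haF, ha⟩ : ∃ a ∈ F, a ∉ F.image g := by
      by_contra! h
      have hE : F = F.image g := Finset.eq_of_subset_of_card_le h Finset.card_image_le
      have := hac F subset_rfl fun c hc => by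
        rw [hE]; exact Finset.mem_image_of_mem g hc
      simp [this] at hF
    have ha' : ∀ u ∈ F, g u ≠ a := fun u hu h => ha (h ▸ Finset.mem_image_of_mem g hu)
    have haS := hFS haF
    -- By injectivity no other prescribed pair ends in `g a`, so inserting `a` before `g a` breaks
    -- none.
    have hne : ∀ u ∈ F.erase a, g u ≠ g a := fun u hu h =>
      (Finset.ne_of_mem_erase hu) (hinj (Finset.mem_of_mem_erase hu) haF h)
    rw [show S.card - (k + 1) = (S.erase a).card - k by rw [Finset.card_erase_of_mem haS]; omega,
      ← ih (S.erase a) (F.erase a) (by rw [Finset.card_erase_of_mem haF, hF]; rfl)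
        (Finset.erase_subset_erase a hFS)
        (fun u hu => Finset.mem_erase.2
          ⟨ha' u (Finset.mem_of_mem_erase hu), hg u (Finset.mem_of_mem_erase hu)⟩)
        (hinj.mono (by simp))
        (fun C hC h => hac C (hC.trans (Finset.erase_subset _ _)) h)]
    have split : ∀ l ∈ orderings g S F, ∃ l₁ l₂, l = l₁ ++ a :: g a :: l₂ ∧ a ∉ l₁ := by
      intro l hl
      rw [mem_orderings] at hl
      obtain ⟨s, t, h⟩ := hl.2 a haF
      refine ⟨s, t, by simp [← h], fun hs => ?_⟩
      have := hl.1.1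
      rw [← h] at this
      simp [List.nodup_append] at this
      exact (this.2.2 a hs).1 rfl
    refine Finset.card_bij' (fun l _ => l.erase a)
      (fun l _ => l.takeWhile (· ≠ g a) ++ a :: l.dropWhile (· ≠ g a)) ?_ ?_ ?_ ?_
    · intro l hl
      obtain ⟨l₁, l₂, rfl, h1⟩ := split l hl
      rw [mem_orderings] at hl ⊢
      obtain ⟨⟨hn, hm⟩, hF⟩ := hl
      refine ⟨⟨hn.erase a, fun x => ?_⟩, fun u hu => ?_⟩
      · rw [hn.mem_erase_iff, hm, Finset.mem_erase]
      · have := hF u (Finset.mem_of_mem_erase hu)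
        rw [infix_pair_append_cons (Finset.ne_of_mem_erase hu)
          (ha' u (Finset.mem_of_mem_erase hu))] at this
        rw [List.erase_append_right _ h1, List.erase_cons_head,
          infix_pair_append_cons_of_ne (hne u hu)]
        exact this
    · intro l hl
      rw [mem_orderings] at hl ⊢
      obtain ⟨⟨hn, hm⟩, hF⟩ := hl
      have hal : a ∉ l := fun h => by simpa using (hm a).1 h
      have hga : g a ∈ l := (hm _).2 (Finset.mem_erase.2 ⟨ha' a haF, hg a haF⟩)
      obtain ⟨l₁, l₂, rfl⟩ := List.append_of_mem hga
      have h1 : g a ∉ l₁ := fun h => by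
        simp [List.nodup_append] at hn
        exact (hn.2.2 _ h).1 rfl
      have hp : ∀ x ∈ l₁, decide (x ≠ g a) = true :=
        fun x hx => decide_eq_true fun h => h1 (by rwa [← h])
      have e1 : (l₁ ++ g a :: l₂).takeWhile (· ≠ g a) = l₁ := by
        rw [List.takeWhile_append_of_pos hp]
        simp
      have e2 : (l₁ ++ g a :: l₂).dropWhile (· ≠ g a) = g a :: l₂ := by
        rw [List.dropWhile_append_of_pos hp]
        simp
      rw [e1, e2]
      refine ⟨⟨?_, fun x => ?_⟩, fun u hu => ?_⟩
      · rw [List.nodup_middle, List.nodup_cons]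
        exact ⟨hal, hn⟩
      · have := hm x
        rw [Finset.mem_erase] at this
        rw [List.mem_append, List.mem_cons, or_left_comm, ← List.mem_append, this]
        by_cases hx : x = a <;> simp [hx, haS]
      · by_cases hua : u = a
        · subst hua; exact ⟨l₁, l₂, by simp⟩
        · have hu' := Finset.mem_erase.2 ⟨hua, hu⟩
          rw [infix_pair_append_cons hua (ha' u hu),
            ← infix_pair_append_cons_of_ne (hne u hu')]
          exact hF u hu'
    · intro l hl
      obtain ⟨l₁, l₂, rfl, h1⟩ := split l hl
      rw [mem_orderings] at hl
      have hn := hl.1.1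
      have h2 : g a ∉ l₁ := fun h => by
        simp [List.nodup_append] at hn
        exact (hn.2.2 _ h).2.1 rfl
      have hp : ∀ x ∈ l₁, decide (x ≠ g a) = true :=
        fun x hx => decide_eq_true fun h => h2 (by rwa [← h])
      simp only [List.erase_append_right _ h1, List.erase_cons_head]
      rw [List.takeWhile_append_of_pos hp, List.dropWhile_append_of_pos hp]
      simp
    · intro l hl
      rw [mem_orderings] at hl
      have hal : a ∉ l := fun h => by simpa using (hl.1.2 a).1 h
      have : a ∉ l.takeWhile (· ≠ g a) := fun h => hal ((List.takeWhile_prefix _).subset h)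
      simp only [List.erase_append_right _ this, List.erase_cons_head, List.takeWhile_append_dropWhile]

/-- An extension amounts to a bijection from the complement of `F` to the complement of `g '' F`. -/
theorem card_perm_extending {V : Type*} [Fintype V] [DecidableEq V] (g : V → V) (F : Finset V)
    (hinj : Set.InjOn g F) :
    (Finset.univ.filter fun σ : Equiv.Perm V => ∀ u ∈ F, σ u = g u).card =
      (Fintype.card V - F.card).factorial := by
  classical
  let e₀ : (F : Set V) ≃ (g '' (F : Set V)) := Equiv.Set.imageOfInjOn g F hinj
  have e := Equiv.Set.compl e₀
  have h1 : Fintype.card ((F : Set V)ᶜ : Set V) = Fintype.card V - F.card := by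
    rw [Fintype.card_compl_set]; simp
  have h2 : Fintype.card ((g '' (F : Set V))ᶜ : Set V) = Fintype.card V - F.card := by
    rw [Fintype.card_compl_set, ← Fintype.card_congr e₀]; simp
  rw [← h1, ← Fintype.card_equiv (Fintype.equivOfCardEq (h1.trans h2.symm)),
    ← Fintype.card_congr e, ← Fintype.card_subtype]
  refine Fintype.card_congr (Equiv.subtypeEquivRight fun σ => ?_)
  simp [e₀, Equiv.Set.imageOfInjOn]

/-! ### Listings, and the cycles of a permutation. -/

section Listings

variable {V : Type*} {n : ℕ}

/-- The cyclic permutation sending each vertex to the next one in the listing `τ`. -/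
def cyclicNext (τ : Fin n ≃ V) : Equiv.Perm V := τ.permCongr (finRotate n)

theorem cyclicNext_apply (τ : Fin n ≃ V) {i j : Fin n} (h : (i : ℕ) + 1 = j) :
    cyclicNext τ (τ i) = τ j := by
  obtain ⟨i, hi⟩ := i
  obtain ⟨j, hj⟩ := j
  obtain rfl : i + 1 = j := h
  obtain _ | m := n
  · omega
  · simp [cyclicNext, Equiv.permCongr_apply, finRotate_of_lt (show i < m by omega)]

variable [Fintype V]

/-- The vertices of the listing `τ` other than the last one. -/
def nonLast (τ : Fin n ≃ V) : Finset V := Finset.univ.filter fun u => (τ.symm u : ℕ) + 1 < n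

theorem mem_nonLast_iff (τ : Fin n ≃ V) {u : V} :
    u ∈ nonLast τ ↔ ∃ i j : Fin n, (i : ℕ) + 1 = j ∧ τ i = u := by
  simp only [nonLast, Finset.mem_filter, Finset.mem_univ, true_and]
  constructor
  · exact fun h => ⟨τ.symm u, ⟨_, h⟩, rfl, by simp⟩
  · rintro ⟨i, j, h, rfl⟩
    simp [h]

theorem infix_pair_ofFn_iff (τ : Fin n ≃ V) {x y : V} :
    [x, y] <:+: List.ofFn τ ↔ x ∈ nonLast τ ∧ cyclicNext τ x = y := by
  rw [mem_nonLast_iff, List.infix_iff_getElem?]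
  constructor
  · rintro ⟨k, hk, h⟩
    have hk' : k + 1 < n := by simp at hk; omega
    have h0 := h 0 (by simp)
    have h1 := h 1 (by simp)
    have e1 : τ ⟨k, by omega⟩ = x := by
      simpa [List.getElem?_ofFn, show k < n by omega] using h0
    have e2 : τ ⟨k + 1, hk'⟩ = y := by
      simpa [List.getElem?_ofFn, Nat.add_comm 1 k, hk'] using h1
    refine ⟨⟨⟨k, by omega⟩, ⟨k + 1, hk'⟩, rfl, e1⟩, ?_⟩
    rw [← e1, ← e2]
    exact cyclicNext_apply τ rfl
  · rintro ⟨⟨i, j, h, rfl⟩, rfl⟩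
    rw [cyclicNext_apply τ h]
    refine ⟨i, by simp; omega, fun k hk => ?_⟩
    obtain rfl | rfl : k = 0 ∨ k = 1 := by simp at hk; omega
    · simp
    · simp [Nat.add_comm 1, h]

variable [DecidableEq V]

theorem card_listings_extending (v : Fin n ≃ V) (g : V → V) (F : Finset V)
    (hinj : Set.InjOn g F) (hac : IsAcyclicOn g F) :
    (Finset.univ.filter fun τ : Fin n ≃ V =>
      F ⊆ nonLast τ ∧ ∀ u ∈ F, cyclicNext τ u = g u).card =
      (Fintype.card V - F.card).factorial := by
  rw [← Finset.card_univ, ← card_orderings g F.card Finset.univ F rfl (Finset.subset_univ _)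
    (fun _ _ => Finset.mem_univ _) hinj hac]
  have hcard : Fintype.card V = n := by simpa using (Fintype.card_congr v).symm
  refine Finset.card_bij (fun τ _ => List.ofFn τ) ?_ ?_ ?_
  · intro τ hτ
    simp only [Finset.mem_filter, Finset.mem_univ, true_and] at hτ
    refine mem_orderings.2 ⟨⟨List.nodup_ofFn.2 τ.injective, fun x => ?_⟩, fun u hu =>
      (infix_pair_ofFn_iff τ).2 ⟨hτ.1 hu, hτ.2 u hu⟩⟩
    simp [List.mem_ofFn, τ.surjective x]
  · exact fun τ _ τ' _ h => DFunLike.coe_injective (List.ofFn_injective h)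
  · intro l hl
    rw [mem_orderings] at hl
    obtain ⟨⟨hn, hm⟩, hF⟩ := hl
    have hlen : l.length = n := by
      rw [← List.toFinset_card_of_nodup hn, ← hcard, ← Finset.card_univ]
      congr 1
      ext x
      simp [hm]
    subst hlen
    have hb : Function.Bijective l.get := by
      rw [Fintype.bijective_iff_injective_and_card]
      exact ⟨List.nodup_iff_injective_get.1 hn, by simp [hcard]⟩
    have hof : List.ofFn (Equiv.ofBijective l.get hb) = l := by
      simp
    refine ⟨Equiv.ofBijective l.get hb, ?_, hof⟩
    simp only [Finset.mem_filter, Finset.mem_univ, true_and]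
    have key := fun u hu => (infix_pair_ofFn_iff (Equiv.ofBijective l.get hb)).1
      (hof.symm ▸ hF u hu)
    exact ⟨fun u hu => (key u hu).1, fun u hu => (key u hu).2⟩

/-- In a nonempty invariant set, the vertex latest in `τ` would have its successor, which comes
later still, in the set. -/
theorem isAcyclicOn_cyclicNext (τ : Fin n ≃ V) {F : Finset V} (hF : F ⊆ nonLast τ) :
    IsAcyclicOn (cyclicNext τ) F := by
  intro C hC h
  by_contra hne
  obtain ⟨c, hc, hmax⟩ :=
    C.exists_max_image (fun u => τ.symm u) (Finset.nonempty_iff_ne_empty.2 hne)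
  obtain ⟨i, j, hij, rfl⟩ := (mem_nonLast_iff τ).1 (hF (hC hc))
  have := hmax _ (h _ hc)
  rw [cyclicNext_apply τ hij] at this
  simp only [Equiv.symm_apply_apply, Fin.le_def] at this
  omega

theorem mem_part_cyclePartition {σ : Equiv.Perm V} {u w : V} :
    w ∈ (cyclePartition σ).part u ↔ σ.SameCycle u w := by
  classical
  rw [cyclePartition]
  exact Finpartition.mem_part_ofSetoid_iff_rel (s := Equiv.Perm.SameCycle.setoid σ)

theorem apply_mem_of_mem_parts {σ : Equiv.Perm V} {γ : Finset V}
    (hγ : γ ∈ (cyclePartition σ).parts) {u : V} (hu : u ∈ γ) : σ u ∈ γ := by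
  rw [← (cyclePartition σ).part_eq_of_mem hγ hu, mem_part_cyclePartition]
  exact Equiv.Perm.sameCycle_apply_right.2 (Equiv.Perm.SameCycle.refl _ _)

/-- Cycles are invariant, and an invariant set contains the whole cycle of each of its elements. -/
theorem isAcyclicOn_perm_iff {σ : Equiv.Perm V} {F : Finset V} :
    IsAcyclicOn σ F ↔ ∀ γ ∈ (cyclePartition σ).parts, ¬ γ ⊆ F := by
  constructor
  · intro h γ hγ hF
    exact ((cyclePartition σ).nonempty_of_mem_parts hγ).ne_empty
      (h γ hF fun c hc => apply_mem_of_mem_parts hγ hc)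
  · intro h C hC hinv
    by_contra hne
    obtain ⟨c, hc⟩ := Finset.nonempty_iff_ne_empty.2 hne
    refine h _ ((cyclePartition σ).part_mem.2 (Finset.mem_univ c)) fun w hw => hC ?_
    rw [mem_part_cyclePartition] at hw
    obtain ⟨k, rfl⟩ := hw.exists_nat_pow_eq
    clear hw
    induction k with
    | zero => simpa using hc
    | succ k ih => rw [pow_succ', Equiv.Perm.mul_apply]; exact hinv _ ih

open Classical in
theorem card_listings_eq_card_perms (v : Fin n ≃ V) (g : V → V) (F : Finset V) :
    (Finset.univ.filter fun τ : Fin n ≃ V =>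
      F ⊆ nonLast τ ∧ ∀ u ∈ F, cyclicNext τ u = g u).card =
    (Finset.univ.filter fun σ : Equiv.Perm V =>
      IsAcyclicOn σ F ∧ ∀ u ∈ F, σ u = g u).card := by
  by_cases h : Set.InjOn g F ∧ IsAcyclicOn g F
  -- Acyclicity of `σ` on `F` is automatic here, since `σ` agrees with `g` there.
  · rw [card_listings_extending v g F h.1 h.2, ← card_perm_extending g F h.1]
    congr 1
    ext σ
    simp only [Finset.mem_filter, Finset.mem_univ, true_and]
    exact ⟨fun e => ⟨h.2.congr fun u hu => (e u hu).symm, e⟩, fun e => e.2⟩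
  · have inj : ∀ σ : Equiv.Perm V, (∀ u ∈ F, σ u = g u) → Set.InjOn g F := fun σ e =>
      (σ.injective.injOn (s := (F : Set V))).congr e
    rw [Finset.filter_false_of_mem fun τ _ e =>
        h ⟨inj _ e.2, (isAcyclicOn_cyclicNext τ e.1).congr e.2⟩,
      Finset.filter_false_of_mem fun σ _ e => h ⟨inj _ e.2, e.1.congr e.2⟩, Finset.card_empty, Finset.card_empty]

/-! ### Weighted sums over listings and over permutations. -/

variable {R : Type*} [CommRing R]

/-- The product sees `k` only through the restriction of `s k` to `F`, so weighted sums reduce to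
counts. -/
theorem sum_prod_fiberwise {ι : Type*} [Fintype ι] (P : ι → Prop) [DecidablePred P]
    (F : Finset V) (s : ι → V → V) (b : V → V → R) :
    ∑ k with P k, ∏ u ∈ F, b u (s k u) =
      ∑ g : F → V, ((Finset.univ.filter fun k => P k ∧ ∀ u (hu : u ∈ F),
        s k u = g ⟨u, hu⟩).card : R) * ∏ u : F, b u (g u) := by
  rw [← Finset.sum_fiberwise _ (fun k (u : F) => s k u)]
  refine Finset.sum_congr rfl fun g _ => ?_
  rw [Finset.filter_filter, ← nsmul_eq_mul]
  have : (Finset.univ.filter fun k => P k ∧ (fun u : F => s k u) = g) =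
      Finset.univ.filter fun k => P k ∧ ∀ u (hu : u ∈ F), s k u = g ⟨u, hu⟩ := by
    ext k
    simp [funext_iff]
  rw [this]
  refine Finset.sum_eq_card_nsmul fun k hk => ?_
  rw [← Finset.prod_coe_sort]
  refine Finset.prod_congr rfl fun u _ => ?_
  rw [(Finset.mem_filter.1 hk).2.2 u u.2]

open Classical in
theorem sum_listings_eq_sum_perms (v : Fin n ≃ V) (b : V → V → R) :
    ∑ τ : Fin n ≃ V, ∏ u ∈ nonLast τ, (1 + b u (cyclicNext τ u)) =
      ∑ σ : Equiv.Perm V, ∑ F with ∀ γ ∈ (cyclePartition σ).parts, ¬ γ ⊆ F,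
        ∏ u ∈ F, b u (σ u) := by
  simp only [Finset.prod_one_add, ← isAcyclicOn_perm_iff]
  rw [Finset.sum_comm' (t' := Finset.univ)
      (s' := fun F => Finset.univ.filter fun τ : Fin n ≃ V => F ⊆ nonLast τ) (by simp),
    Finset.sum_comm' (t' := Finset.univ)
      (s' := fun F => Finset.univ.filter fun σ : Equiv.Perm V => IsAcyclicOn σ F) (by simp)]
  refine Finset.sum_congr rfl fun F _ => ?_
  rw [sum_prod_fiberwise _ F (fun τ => cyclicNext τ), sum_prod_fiberwise (fun σ : Equiv.Perm V => IsAcyclicOn σ F) F (fun σ => σ)]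
  refine Finset.sum_congr rfl fun g _ => ?_
  congr 2
  -- The value `u` off `F` is arbitrary: only `g` on `F` enters the counts.
  have := card_listings_eq_card_perms v (fun u => if hu : u ∈ F then g ⟨u, hu⟩ else u) F
  have e : ∀ p : V → V, (∀ u ∈ F, p u = if hu : u ∈ F then g ⟨u, hu⟩ else u) ↔
      ∀ u (hu : u ∈ F), p u = g ⟨u, hu⟩ := fun p =>
    forall_congr' fun u => forall_congr' fun hu => by rw [dif_pos hu]
  simp only [e] at this
  convert this

/-- Each factor is the sum over proper subsets of its block, and `F` corresponds to the family of
its traces on the disjoint blocks. -/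
theorem prod_disjoint_sub_prod (b : V → R) (P : Finset (Finset V))
    (hP : (P : Set (Finset V)).PairwiseDisjoint id) :
    ∏ γ ∈ P, (∏ u ∈ γ, (1 + b u) - ∏ u ∈ γ, b u) =
      ∑ F ∈ (P.biUnion id).powerset with ∀ γ ∈ P, ¬ γ ⊆ F, ∏ u ∈ F, b u := by
  induction P using Finset.induction_on with
  | empty => simp
  | insert γ P hγ ih =>
    have hd : Disjoint γ (P.biUnion id) := by
      rw [Finset.disjoint_biUnion_right]
      intro δ hδ
      exact hP (by simp) (by simp [hδ]) (fun h => hγ (h ▸ hδ))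
    have hsub : ∏ u ∈ γ, (1 + b u) - ∏ u ∈ γ, b u =
        ∑ A ∈ γ.powerset with ¬ γ ⊆ A, ∏ u ∈ A, b u := by
      rw [Finset.prod_one_add, sub_eq_iff_eq_add,
        ← Finset.sum_filter_not_add_sum_filter _ (fun A => γ ⊆ A)]
      congr 1
      rw [show γ.powerset.filter (fun A => γ ⊆ A) = {γ} by
        ext A
        simp only [Finset.mem_filter, Finset.mem_powerset, Finset.mem_singleton]
        exact ⟨fun h => subset_antisymm h.1 h.2, fun h => by simp [h]⟩, Finset.sum_singleton]
    rw [Finset.prod_insert hγ, ih (hP.subset (by simp)), hsub, Finset.sum_mul_sum,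
      ← Finset.sum_product']
    have hsubset : ∀ δ ∈ P, δ ⊆ P.biUnion id := fun δ hδ => Finset.subset_biUnion_of_mem id hδ
    refine Finset.sum_bij' (fun x _ => x.1 ∪ x.2) (fun F _ => (F ∩ γ, F ∩ P.biUnion id))
      ?_ ?_ ?_ ?_ ?_
    · rintro ⟨A, G⟩ h
      simp only [Finset.mem_product, Finset.mem_filter, Finset.mem_powerset] at h
      simp only [Finset.mem_filter, Finset.mem_powerset, Finset.biUnion_insert, id,
        Finset.forall_mem_insert]
      obtain ⟨⟨hA, hA'⟩, hG, hG'⟩ := h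
      refine ⟨Finset.union_subset_union hA hG, fun h => hA' ?_, fun δ hδ h => hG' δ hδ ?_⟩
      · exact Disjoint.left_le_of_le_sup_right h (hd.mono_right hG)
      · exact Disjoint.left_le_of_le_sup_left h (hd.symm.mono (hsubset δ hδ) hA)
    · intro F h
      simp only [Finset.mem_filter, Finset.mem_powerset, Finset.forall_mem_insert] at h
      simp only [Finset.mem_product, Finset.mem_filter, Finset.mem_powerset]
      refine ⟨⟨Finset.inter_subset_right, fun h' => h.2.1 (h'.trans Finset.inter_subset_left)⟩,
        Finset.inter_subset_right, fun δ hδ h' =>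
          h.2.2 δ hδ (h'.trans Finset.inter_subset_left)⟩
    · rintro ⟨A, G⟩ h
      simp only [Finset.mem_product, Finset.mem_filter, Finset.mem_powerset] at h
      obtain ⟨⟨hA, -⟩, hG, -⟩ := h
      ext x
      · have : x ∈ γ → x ∉ P.biUnion id := fun h => Finset.disjoint_left.1 hd h
        have := fun h : x ∈ A => hA h
        have := fun h : x ∈ G => hG h
        simp only [Finset.mem_inter, Finset.mem_union]
        tauto
      · have : x ∈ γ → x ∉ P.biUnion id := fun h => Finset.disjoint_left.1 hd h
        have := fun h : x ∈ A => hA h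
        have := fun h : x ∈ G => hG h
        simp only [Finset.mem_inter, Finset.mem_union]
        tauto
    · intro F h
      simp only [Finset.mem_filter, Finset.mem_powerset, Finset.biUnion_insert, id] at h
      simp only [← Finset.inter_union_distrib_left]
      exact Finset.inter_eq_left.2 h.1
    · rintro ⟨A, G⟩ h
      simp only [Finset.mem_product, Finset.mem_filter, Finset.mem_powerset] at h
      exact (Finset.prod_union (hd.mono h.1.1 h.2.1)).symm

/-- Listings of the vertices without consecutive pairs of a relation, counted with weights,
against permutations weighted cycle by cycle. -/
theorem sum_listings_eq_sum_prod_cycles (v : Fin n ≃ V) (b : V → V → R) :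
    ∑ τ : Fin n ≃ V, ∏ u ∈ nonLast τ, (1 + b u (cyclicNext τ u)) =
      ∑ σ : Equiv.Perm V, ∏ γ ∈ (cyclePartition σ).parts,
        (∏ u ∈ γ, (1 + b u (σ u)) - ∏ u ∈ γ, b u (σ u)) := by
  classical
  rw [sum_listings_eq_sum_perms v]
  refine Finset.sum_congr rfl fun σ _ => ?_
  rw [prod_disjoint_sub_prod (fun u => b u (σ u)) _ (cyclePartition σ).disjoint,
    (cyclePartition σ).biUnion_parts, Finset.powerset_univ]

end Listings

/-! ### Coefficients of `W` and of the power sums. -/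

section Main

variable {V : Type*} [Fintype V] {n : ℕ} (R : Type*) [CommRing R]

theorem formalSum_monomial_word {ι : Type*} {m : ℕ} {g : ι → Fin m → ℕ+}
    (hg : Function.Injective g) (c : ι → R) (k : ι) :
    formalSum (fun k => c k • monomial R (g k)) (word (g k)) = c k := by
  rw [formalSum, finsum_eq_single _ k]
  · simp [monomial]
  · intro k' hk
    have : word (g k) ≠ word (g k') := fun h => hk (hg (word_injective m h)).symm
    simp [monomial, this]

theorem formalSum_monomial_eq_zero {ι : Type*} {m : ℕ} {g : ι → Fin m → ℕ+} (c : ι → R)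
    {w : FreeMonoid ℕ+} (hw : ∀ k, w ≠ word (g k)) :
    formalSum (fun k => c k • monomial R (g k)) w = 0 := by
  rw [formalSum]
  exact finsum_eq_zero_of_forall_eq_zero fun k => by simp [monomial, hw]

open Classical in
theorem powerSum_apply_word (π : Finpartition (Finset.univ : Finset (Fin n))) (i : Fin n → ℕ+) :
    powerSum R π (word i) =
      if ∀ B ∈ π.parts, ∀ j ∈ B, ∀ k ∈ B, i j = i k then 1 else 0 := by
  split_ifs with h
  · simpa [powerSum] using formalSum_monomial_word R
      (g := fun i : {i : Fin n → ℕ+ // ∀ B ∈ π.parts, ∀ j ∈ B, ∀ k ∈ B, i j = i k} => i.1)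
      Subtype.val_injective (fun _ => 1) ⟨i, h⟩
  · simpa [powerSum] using formalSum_monomial_eq_zero R
      (g := fun i : {i : Fin n → ℕ+ // ∀ B ∈ π.parts, ∀ j ∈ B, ∀ k ∈ B, i j = i k} => i.1)
      (fun _ => 1) (w := word i) fun k hk => h (word_injective n hk ▸ k.2)

theorem powerSum_apply_eq_zero (π : Finpartition (Finset.univ : Finset (Fin n)))
    {w : FreeMonoid ℕ+} (hw : ∀ i : Fin n → ℕ+, w ≠ word i) : powerSum R π w = 0 := by
  simpa [powerSum] using formalSum_monomial_eq_zero R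
    (g := fun i : {i : Fin n → ℕ+ // ∀ B ∈ π.parts, ∀ j ∈ B, ∀ k ∈ B, i j = i k} => i.1)
    (fun _ => 1) fun k => hw k.1

theorem const_on_cycles_iff {α β : Type*} [Fintype α] [DecidableEq α] (σ : Equiv.Perm α)
    (i : α → β) :
    (∀ B ∈ (cyclePartition σ).parts, ∀ j ∈ B, ∀ k ∈ B, i j = i k) ↔ ∀ j, i (σ j) = i j := by
  constructor
  · intro h j
    have hB := (cyclePartition σ).part_mem.2 (Finset.mem_univ j)
    have hj := (cyclePartition σ).mem_part (Finset.mem_univ j)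
    exact h _ hB _ (apply_mem_of_mem_parts hB hj) _ hj
  · intro h B hB j hj k hk
    rw [← (cyclePartition σ).part_eq_of_mem hB hj, mem_part_cyclePartition] at hk
    obtain ⟨m, rfl⟩ := hk.exists_nat_pow_eq
    clear hk
    induction m with
    | zero => simp
    | succ m ih => rw [pow_succ', Equiv.Perm.mul_apply, h, ih]

open Classical in
theorem powerSum_cycleType_apply_word (v : Fin n ≃ V) (σ : Equiv.Perm V) (f : V → ℕ+) :
    powerSum R (cycleType v σ) (word fun j => f (v j)) = if ∀ u, f (σ u) = f u then 1 else 0 := by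
  rw [powerSum_apply_word]
  refine if_congr ?_ rfl rfl
  rw [cycleType, const_on_cycles_iff, ← v.forall_congr_right]
  simp

/-- The pairs `(u, w)` that may not be consecutive in an `(f, X)`-friendly listing. -/
def Forbidden (X : Digraph V) (f : V → ℕ+) (u w : V) : Prop :=
  f w < f u ∨ f u = f w ∧ X.Adj u w

open Classical in
theorem friendlyIndicator_eq_prod (X : Digraph V) (f : V → ℕ+) (τ : Fin n ≃ V) :
    friendlyIndicator R X f τ =
      ∏ u ∈ nonLast τ, (1 + if Forbidden X f u (cyclicNext τ u) then (-1 : R) else 0) := by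
  have h : ∀ u w, (1 + if Forbidden X f u w then (-1 : R) else 0) =
      if ¬ Forbidden X f u w then 1 else 0 := fun u w => by split_ifs <;> simp_all
  simp only [h, Finset.prod_ite_zero, Finset.prod_const_one, friendlyIndicator]
  refine if_congr ⟨fun hf u hu => ?_, fun hf => ?_⟩ rfl rfl
  · obtain ⟨i, j, hij, rfl⟩ := (mem_nonLast_iff τ).1 hu
    rw [cyclicNext_apply τ hij]
    rintro (h | ⟨h, hX⟩)
    · exact absurd (hf.1 i j hij) (not_le.2 h)
    · exact absurd (hf.2 i j hij hX) (by simp [h])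
  · have key : ∀ i j : Fin n, (i : ℕ) + 1 = j → ¬ Forbidden X f (τ i) (τ j) := fun i j hij => by
      rw [← cyclicNext_apply τ hij]
      exact hf _ ((mem_nonLast_iff τ).2 ⟨i, j, hij, rfl⟩)
    refine ⟨fun i j hij => not_lt.1 fun h => key i j hij (.inl h), fun i j hij hX => ?_⟩
    have h1 := not_lt.1 fun h => key i j hij (.inl h)
    exact lt_of_le_of_ne h1 fun h => key i j hij (.inr ⟨h, hX⟩)

variable [DecidableEq V]

theorem W_eq_formalSum (X : Digraph V) (v : Fin n ≃ V) :
    W R X v = formalSum fun f : V → ℕ+ =>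
      (∑ τ : Fin n ≃ V, friendlyIndicator R X f τ) • monomial R (fun j => f (v j)) := by
  simp only [W, Finset.sum_smul]

theorem W_apply_word (X : Digraph V) (v : Fin n ≃ V) (f : V → ℕ+) :
    W R X v (word fun j => f (v j)) = ∑ τ : Fin n ≃ V, friendlyIndicator R X f τ := by
  rw [W_eq_formalSum]
  exact formalSum_monomial_word R (g := fun (f : V → ℕ+) j => f (v j))
    (fun f f' h => v.surjective.injective_comp_right h)
    (fun f => ∑ τ : Fin n ≃ V, friendlyIndicator R X f τ) f

theorem W_apply_eq_zero (X : Digraph V) (v : Fin n ≃ V) {w : FreeMonoid ℕ+}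
    (hw : ∀ i : Fin n → ℕ+, w ≠ word i) : W R X v w = 0 := by
  rw [W_eq_formalSum]
  exact formalSum_monomial_eq_zero R _ fun f => hw _

/-- `σ` permutes `γ`. With equal sums, an `h` that is monotone along the cycle must be constant on
it. -/
theorem sum_apply_of_mem_parts {σ : Equiv.Perm V} {γ : Finset V}
    (hγ : γ ∈ (cyclePartition σ).parts) (h : V → ℕ) : ∑ u ∈ γ, h (σ u) = ∑ u ∈ γ, h u := by
  have : γ.map σ.toEmbedding = γ := Finset.eq_of_subset_of_card_le
    (fun x hx => by
      obtain ⟨u, hu, rfl⟩ := Finset.mem_map.1 hx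
      exact apply_mem_of_mem_parts hγ hu) (by simp)
  conv_rhs => rw [← this, Finset.sum_map]
  rfl

open Classical in
theorem prod_cycles_eq (X : Digraph V) (f : V → ℕ+) (σ : Equiv.Perm V) :
    ∏ γ ∈ (cyclePartition σ).parts,
      (∏ u ∈ γ, (1 + if Forbidden X f u (σ u) then (-1 : R) else 0) -
        ∏ u ∈ γ, if Forbidden X f u (σ u) then (-1 : R) else 0) =
      if σ ∈ permsOf X ∧ ∀ u, f (σ u) = f u then (-1) ^ phi X σ else 0 := by
  have h : ∀ u w, (1 + if Forbidden X f u w then (-1 : R) else 0) =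
      if ¬ Forbidden X f u w then 1 else 0 := fun u w => by split_ifs <;> simp_all
  simp only [h, Finset.prod_ite_zero, Finset.prod_const_one, Finset.prod_const]
  by_cases hf : ∀ u, f (σ u) = f u
  · have hfor : ∀ u, Forbidden X f u (σ u) ↔ X.Adj u (σ u) := fun u => by simp [Forbidden, hf]
    have hc : ∀ γ, (∀ u ∈ γ, ¬ Forbidden X f u (σ u)) ↔ IsCycleOf Xᶜ σ γ := fun γ => by
      simp [hfor, IsCycleOf]
    have hX : ∀ γ, (∀ u ∈ γ, Forbidden X f u (σ u)) ↔ IsCycleOf X σ γ := fun γ => by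
      simp [hfor, IsCycleOf]
    simp only [hc, hX]
    by_cases hσ : σ ∈ permsOf X
    · rw [if_pos ⟨hσ, hf⟩, phi, ← Finset.prod_pow_eq_pow_sum, Finset.prod_filter]
      refine Finset.prod_congr rfl fun γ hγ => ?_
      obtain ⟨u, hu⟩ := (cyclePartition σ).nonempty_of_mem_parts hγ
      have hor := (Finset.mem_filter.1 hσ).2 γ hγ
      by_cases hγX : IsCycleOf X σ γ
      · have hγc : ¬ IsCycleOf Xᶜ σ γ := fun h' => by
          rw [← hc] at h'
          exact h' u hu ((hfor u).2 (hγX u hu))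
        -- With `ℓ = m + 1` the factor is `0 - (-1) ^ (m + 1) = (-1) ^ m`.
        obtain ⟨m, hm⟩ := Nat.exists_eq_succ_of_ne_zero (Finset.card_pos.2 ⟨u, hu⟩).ne'
        simp [hγX, hγc, hm, pow_succ]
      · simp [hγX, hor.resolve_left hγX]
    · rw [if_neg fun h => hσ h.1]
      simp only [permsOf, Finset.mem_filter, Finset.mem_univ, true_and, not_forall] at hσ
      obtain ⟨γ, hγ, h'⟩ := hσ
      rw [not_or] at h'
      exact Finset.prod_eq_zero hγ (by simp [h'])
  · rw [if_neg fun h => hf h.2]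
    push Not at hf
    obtain ⟨w, hw⟩ := hf
    have hγ := (cyclePartition σ).part_mem.2 (Finset.mem_univ w)
    have hwγ := (cyclePartition σ).mem_part (Finset.mem_univ w)
    have hsum := sum_apply_of_mem_parts hγ fun u => (f u : ℕ)
    refine Finset.prod_eq_zero hγ ?_
    rw [if_neg, if_neg, sub_zero]
    -- All steps forbidden: `f` weakly decreases around the cycle, hence is constant.
    · intro hall
      refine hw (PNat.coe_injective ((Finset.sum_eq_sum_iff_of_le fun u hu => ?_).1 hsum w hwγ))
      rcases hall u hu with h | h
      · exact_mod_cast h.le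
      · simp [h.1]
    -- No step forbidden: `f` weakly increases around the cycle, hence is constant.
    · intro hall
      refine hw (PNat.coe_injective
        ((Finset.sum_eq_sum_iff_of_le fun u hu => ?_).1 hsum.symm w hwγ).symm)
      exact_mod_cast not_lt.1 fun h => hall u hu (.inl h)

end Main

end RedeiBerge

theorem mainTheorem1 (R : Type*) [CommRing R] {V : Type*} [Fintype V] [DecidableEq V] {n : ℕ}
    (X : Digraph V) (v : Fin n ≃ V) :
    RedeiBerge.W R X v =
      ∑ σ ∈ RedeiBerge.permsOf X,
        ((-1 : R) ^ RedeiBerge.phi X σ) • RedeiBerge.powerSum R (RedeiBerge.cycleType v σ) := by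
  classical
  funext w
  simp only [Finset.sum_apply, Pi.smul_apply]
  by_cases hw : ∃ i : Fin n → ℕ+, w = RedeiBerge.word i
  · obtain ⟨i, rfl⟩ := hw
    obtain ⟨f, rfl⟩ : ∃ f : V → ℕ+, i = fun j => f (v j) := ⟨i ∘ v.symm, by ext; simp⟩
    rw [RedeiBerge.W_apply_word]
    simp only [RedeiBerge.friendlyIndicator_eq_prod, RedeiBerge.powerSum_cycleType_apply_word]
    rw [RedeiBerge.sum_listings_eq_sum_prod_cycles v
      fun u w => if RedeiBerge.Forbidden X f u w then (-1 : R) else 0]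
    simp [RedeiBerge.prod_cycles_eq, ite_and]
  -- Words of length other than `n` have coefficient zero on both sides.
  · push Not at hw
    simp [RedeiBerge.W_apply_eq_zero R X v hw, RedeiBerge.powerSum_apply_eq_zero R _ hw]
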